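/- Let $1<p<\infty$, let $n,d\ge 0$ be integers, and let $\mathbf T=(T_1,\dots,T_d)$ be a commuting $d$-tuple of complex $n\times n$ matrices that is Taylor invertible, that is, whose Koszul complex on $\mathbb C^n$ is exact. For any $d$-tuple $\mathbf S=(S_1,\dots,S_d)$ of $n\times n$ matrices put $\|\mathbf S\|_{s,p}=\big[\operatorname{tr}\big((\sum_{i=1}^d S_i^*S_i)^{p/2}\big)\big]^{1/p}$. Let $P=(\sum_{i=1}^d T_i^*T_i)^{1/2}$ and let $\mathbf T=\mathbf VP=(V_1P,\dots,V_dP)$ be the canonical spherical polar decomposition, i.e. $\sum_i V_i^*V_i$ is the orthogonal projection onto $(\ker P)^\perp$. Let $$\widetilde{\mathbf T}=\big(P^{1/2}V_iP^{1/2}\big)_{i=1}^d,\qquad \widehat{\mathbf T}(t)=\Big(\tfrac12\big(P^tV_iP^{1-t}+P^{1-t}V_iP^t\big)\Big)_{i=1}^d$$ be the spherical Aluthge transform and the spherical Heinz transform. Then the following are equivalent: (i) $\|\widetilde{\mathbf T}\|_{s,p}=\|\widehat{\mathbf T}(t)\|_{s,p}$ for some $t\in(0,1)$ with $t\ne\frac12$;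 (ii) $\|\widetilde{\mathbf T}\|_{s,p}=\|\widehat{\mathbf T}(t)\|_{s,p}$ for all $t\in(0,1)$ with $t\ne\frac12$; (iii) $\mathbf T$ is normal, i.e. commuting with every $T_i$ normal. -/

import Mathlib

open scoped MatrixOrder

noncomputable section

namespace SphericalTuple

variable {n d : ℕ}

/-- A tuple of matrices is commuting if its entries commute pairwise. -/
def IsCommuting (T : Fin d → Matrix (Fin n) (Fin n) ℂ) : Prop :=
  ∀ i j, T i * T j = T j * T i

/-- A tuple is normal if it is commuting and each of its entries is normal. -/
def IsNormal (T : Fin d → Matrix (Fin n) (Fin n) ℂ) : Prop :=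
  IsCommuting T ∧ ∀ i, IsStarNormal (T i)

/-- The `k`-th space of the Koszul complex on `H = ℂⁿ`: `H ⊗ Λᵏ ℂᵈ`, that is, the direct sum of
copies of `H` indexed by the `k`-element subsets of the `d` indices. -/
abbrev Koszul (n d k : ℕ) : Type :=
  {s : Finset (Fin d) // s.card = k} → (Fin n → ℂ)

/-- The Koszul differential `x ⊗ e_s ↦ ∑ i, T i x ⊗ (e_i ∧ e_s)` in coordinates: the entry of the
image at `s` is the sum over `i ∈ s` of `± T i` applied to the entry at `s \ {i}`, with sign `-1` to
the number of elements of `s` smaller than `i`. For `d = 2` the maps are `x ↦ (T₁ x, T₂ x)` and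
`(x, y) ↦ -T₂ x + T₁ y`. -/
def koszulD (T : Fin d → Matrix (Fin n) (Fin n) ℂ) (k : ℕ) :
    Koszul n d k →ₗ[ℂ] Koszul n d (k + 1) where
  toFun f s := ∑ i : {i // i ∈ s.1},
    (-1 : ℂ) ^ (s.1.filter (fun j => j < i.1)).card •
      (T i.1).mulVec (f ⟨s.1.erase i.1, by rw [Finset.card_erase_of_mem i.2, s.2]; rfl⟩)
  map_add' f g := by
    funext s
    simp [Matrix.mulVec_add, Finset.sum_add_distrib]
  map_smul' c f := by
    funext s
    simp only [Pi.smul_apply, Matrix.mulVec_smul, RingHom.id_apply, Finset.smul_sum]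
    exact Finset.sum_congr rfl fun i _ => smul_comm _ _ _

/-- A tuple is Taylor invertible if its Koszul complex `0 → K₀ → K₁ → ⋯ → K_d → 0` is exact. The
spaces `K_k` with `k > d` are zero, so exactness at `K_d` says that the last map is onto. -/
def IsTaylorInvertible (T : Fin d → Matrix (Fin n) (Fin n) ℂ) : Prop :=
  Function.Injective (koszulD T 0) ∧
    ∀ k, Function.Exact (koszulD T k) (koszulD T (k + 1))

/-- `P = (T₁* T₁ + ⋯ + T_d* T_d)^{1/2}`. -/
def modulus (T : Fin d → Matrix (Fin n) (Fin n) ℂ) : Matrix (Fin n) (Fin n) ℂ :=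
  CFC.sqrt (∑ i, star (T i) * T i)

/-- The spherical Schatten `p`-norm `(tr (P ^ p)) ^ (1 / p)`. -/
def schattenNorm (p : ℝ) (T : Fin d → Matrix (Fin n) (Fin n) ℂ) : ℝ :=
  (Matrix.trace (modulus T ^ p)).re ^ (1 / p)

/-- The partial isometry `V` of the canonical spherical polar decomposition `T i = V i * P`:
`V i = T i * P⁺`, where `P⁺` is the inverse of `P` on the orthogonal complement of its kernel and
zero on its kernel. -/
def polarPart (T : Fin d → Matrix (Fin n) (Fin n) ℂ) (i : Fin d) : Matrix (Fin n) (Fin n) ℂ :=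
  T i * cfc (fun x : ℝ => x⁻¹) (modulus T)

/-- The generalized spherical Aluthge transform. -/
def genAluthge (T : Fin d → Matrix (Fin n) (Fin n) ℂ) (t : ℝ) (i : Fin d) :
    Matrix (Fin n) (Fin n) ℂ :=
  modulus T ^ t * polarPart T i * modulus T ^ (1 - t)

/-- The spherical Aluthge transform. -/
def aluthge (T : Fin d → Matrix (Fin n) (Fin n) ℂ) (i : Fin d) : Matrix (Fin n) (Fin n) ℂ :=
  modulus T ^ (1 / 2 : ℝ) * polarPart T i * modulus T ^ (1 / 2 : ℝ)

/-- The spherical Heinz transform. -/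
def heinz (T : Fin d → Matrix (Fin n) (Fin n) ℂ) (t : ℝ) (i : Fin d) :
    Matrix (Fin n) (Fin n) ℂ :=
  (1 / 2 : ℂ) • (genAluthge T t i + genAluthge T (1 - t) i)

theorem modulus_nonneg (T : Fin d → Matrix (Fin n) (Fin n) ℂ) : 0 ≤ modulus T :=
  CFC.sqrt_nonneg _

theorem modulus_mul_self (T : Fin d → Matrix (Fin n) (Fin n) ℂ) :
    modulus T * modulus T = ∑ i, star (T i) * T i :=
  CFC.sqrt_mul_sqrt_self _ (Finset.sum_nonneg fun i _ => star_mul_self_nonneg (T i))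

theorem modulus_pinv (T : Fin d → Matrix (Fin n) (Fin n) ℂ) :
    star (modulus T) = modulus T ∧
      star (cfc (fun x : ℝ => x⁻¹) (modulus T)) = cfc (fun x : ℝ => x⁻¹) (modulus T) ∧
      modulus T * cfc (fun x : ℝ => x⁻¹) (modulus T) =
        cfc (fun x : ℝ => x⁻¹) (modulus T) * modulus T ∧
      modulus T * (cfc (fun x : ℝ => x⁻¹) (modulus T) * modulus T) = modulus T := by
  have hsa : IsSelfAdjoint (modulus T) := IsSelfAdjoint.of_nonneg (modulus_nonneg T)
  set G := cfc (fun x : ℝ => x⁻¹) (modulus T)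
  have hGsa : star G = G := IsSelfAdjoint.cfc.star_eq
  have hid : cfc (fun x : ℝ => x) (modulus T) = modulus T := cfc_id' ℝ (modulus T)
  have hcont : ∀ f : ℝ → ℝ, ContinuousOn f (spectrum ℝ (modulus T)) := fun f =>
    (Matrix.finite_real_spectrum (A := modulus T)).continuousOn f
  have hcomm : modulus T * G = G * modulus T := by
    have := cfc_commute_cfc (fun x : ℝ => x) (fun x : ℝ => x⁻¹) (modulus T)
    rw [hid] at this
    exact this
  have hPGP : modulus T * (G * modulus T) = modulus T := by
    have h1 : cfc (fun x : ℝ => x * (x⁻¹ * x)) (modulus T) = modulus T * (G * modulus T) := by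
      rw [cfc_mul _ _ _ (hcont _) (hcont _), cfc_mul _ _ _ (hcont _) (hcont _), hid]
    rw [← h1]
    conv_rhs => rw [← hid]
    congr 1
    funext x
    by_cases hx : x = 0
    · simp [hx]
    · field_simp
  exact ⟨hsa.star_eq, hGsa, hcomm, hPGP⟩

open scoped ComplexOrder in
/-- `T i = V i * P`. -/
theorem polarPart_mul_modulus (T : Fin d → Matrix (Fin n) (Fin n) ℂ) (i : Fin d) :
    polarPart T i * modulus T = T i := by
  obtain ⟨hsa, hGsa, hcomm, hPGP⟩ := modulus_pinv T
  set G := cfc (fun x : ℝ => x⁻¹) (modulus T) with hG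
  have hz : ∑ j, star (T j * (1 - G * modulus T)) * (T j * (1 - G * modulus T)) = 0 := by
    have h2 : ∑ j, star (T j * (1 - G * modulus T)) * (T j * (1 - G * modulus T)) =
        star (1 - G * modulus T) * (∑ j, star (T j) * T j) * (1 - G * modulus T) := by
      rw [Finset.mul_sum, Finset.sum_mul]
      exact Finset.sum_congr rfl fun j _ => by rw [star_mul]; noncomm_ring
    rw [h2, ← modulus_mul_self, mul_assoc, mul_assoc, mul_sub, mul_one, hPGP, sub_self, mul_zero,
      mul_zero]
  have h3 := (Finset.sum_eq_zero_iff_of_nonneg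
    (fun j _ => star_mul_self_nonneg (T j * (1 - G * modulus T)))).1 hz i (Finset.mem_univ i)
  have h4 : T i * (1 - G * modulus T) = 0 := Matrix.conjTranspose_mul_self_eq_zero.1 h3
  rw [mul_sub, mul_one, sub_eq_zero] at h4
  rw [polarPart, mul_assoc]
  exact h4.symm

/-- `V₁* V₁ + ⋯ + V_d* V_d` is an orthogonal projection, so that `V` is a spherical partial
isometry, and its kernel is that of `P`. -/
theorem isStarProjection_polarPart (T : Fin d → Matrix (Fin n) (Fin n) ℂ) :
    IsStarProjection (∑ i, star (polarPart T i) * polarPart T i) ∧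
      ∀ x : Fin n → ℂ, (∑ i, star (polarPart T i) * polarPart T i).mulVec x = 0 ↔
        (modulus T).mulVec x = 0 := by
  obtain ⟨hsa, hGsa, hcomm, hPGP⟩ := modulus_pinv T
  set G := cfc (fun x : ℝ => x⁻¹) (modulus T) with hG
  have hsum : ∑ i, star (polarPart T i) * polarPart T i = G * modulus T := by
    have h2 : ∑ i, star (polarPart T i) * polarPart T i = G * (∑ i, star (T i) * T i) * G := by
      rw [Finset.mul_sum, Finset.sum_mul]
      refine Finset.sum_congr rfl fun i _ => ?_
      rw [polarPart, star_mul, ← hG, hGsa]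
      noncomm_ring
    rw [h2, ← modulus_mul_self, mul_assoc, mul_assoc, hcomm, hPGP]
  rw [hsum]
  refine ⟨⟨?_, ?_⟩, fun x => ⟨fun h => ?_, fun h => ?_⟩⟩
  · rw [IsIdempotentElem, mul_assoc, hPGP]
  · rw [IsSelfAdjoint, star_mul, hGsa, hsa, hcomm]
  · rw [← hPGP, ← Matrix.mulVec_mulVec, h, Matrix.mulVec_zero]
  · rw [← Matrix.mulVec_mulVec, h, Matrix.mulVec_zero]

end SphericalTuple

end

/-! Taylor invertibility makes `P` invertible. Put the tuples `X = P^{1-t} V P^t` and `Y = P^t V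
P^{1-t}` off the diagonal of one block operator `M = [[0, X*], [Y, 0]]`. Then `M` is similar,
through a power of `P`, to the self-adjoint dilation `N` of the Aluthge transform, and the real part
`R` of `M` is the dilation of the Heinz transform. The Schatten norms are moments of `|x| ^ p` over
the spectra of `N` and `R`, so (i) says that `N` and `R` have the same strictly convex trace. In an
orthonormal basis that triangularizes `M`, the diagonal of `R` consists of the real eigenvalues of
`M`, which are those of `N`. Equality in Peierls' inequality makes `R` diagonal there, hence `M`
too, and `M = R` (`isSymmetric_of_sum_convex_eq`). So `X = Y`, and `P^{2t-1}`, hence `P`, commutes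
with `V`. Then `V` is a commuting spherical isometry; in finite dimension it is normal
(`commute_adjoint_of_sphericalIsometry`), and so is `T = VP`. Conversely, for normal `T` all the
transforms equal `T`. -/

theorem strictConvexOn_abs_rpow {p : ℝ} (hp : 1 < p) :
    StrictConvexOn ℝ Set.univ (fun x : ℝ => |x| ^ p) := by
  refine ⟨convex_univ, fun x _ y _ hxy a b ha hb hab => ?_⟩
  have hp0 : 0 < p := by linarith
  have htri : |a * x + b * y| ≤ a * |x| + b * |y| := by
    simpa [abs_mul, abs_of_pos ha, abs_of_pos hb] using abs_add_le (a * x) (b * y)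
  simp only [smul_eq_mul]
  -- If `y = -x`, the triangle inequality is strict; otherwise the strictness comes from the power
  -- function on `[0, ∞)`.
  by_cases h : |x| = |y|
  · have hy : y = -x := by
      rcases abs_eq_abs.1 h with h | h
      · exact absurd h hxy
      · linarith
    have hx : 0 < |x| := by
      rw [abs_pos]
      rintro rfl
      simp [hy] at hxy
    have hlt : |a * x + b * y| < |x| := by
      rw [hy, show a * x + b * -x = (a - b) * x by ring, abs_mul]
      have : |a - b| < 1 := abs_lt.2 ⟨by linarith, by linarith⟩
      nlinarith
    rw [← h, ← add_mul, hab, one_mul]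
    exact Real.rpow_lt_rpow (abs_nonneg _) hlt hp0
  · calc |a * x + b * y| ^ p ≤ (a * |x| + b * |y|) ^ p :=
          Real.rpow_le_rpow (abs_nonneg _) htri hp0.le
      _ < a * |x| ^ p + b * |y| ^ p := by
          simpa using (strictConvexOn_rpow hp).2 (abs_nonneg x) (abs_nonneg y) h ha hb hab

/-! ### Equality in Peierls' inequality and triangular form -/

section InnerProduct

variable {E : Type*} [NormedAddCommGroup E] [InnerProductSpace ℂ E]

local notation "⟪" x ", " y "⟫" => inner ℂ x y

/-- The equality case of Peierls' inequality: if the diagonal entries of a diagonalizable symmetric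
operator in an orthonormal basis `u` have the same strictly convex trace as its eigenvalues, then
`u` consists of eigenvectors. -/
theorem apply_eq_smul_of_sum_convex_eq {ι κ : Type*} [Fintype ι] [Fintype κ]
    (R : E →ₗ[ℂ] E) (u : OrthonormalBasis ι ℂ E) (e : OrthonormalBasis κ ℂ E) {ρ : κ → ℝ}
    (he : ∀ k, R (e k) = (ρ k : ℂ) • e k) {f : ℝ → ℝ} (hf : StrictConvexOn ℝ Set.univ f)
    (h : ∑ j, f (⟪u j, R (u j)⟫).re = ∑ k, f (ρ k)) (j : ι) :
    R (u j) = ((⟪u j, R (u j)⟫).re : ℂ) • u j := by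
  have hR : ∀ x, R x = ∑ k, ((ρ k : ℂ) * ⟪e k, x⟫) • e k := fun x => by
    conv_lhs => rw [← e.sum_repr' x]
    simp only [map_sum, map_smul, he, smul_smul, mul_comm]
  have hdiag : ∀ j, (⟪u j, R (u j)⟫).re = ∑ k, ‖⟪e k, u j⟫‖ ^ 2 * ρ k := fun j => by
    rw [hR, inner_sum, Complex.re_sum]
    refine Finset.sum_congr rfl fun k _ => ?_
    rw [inner_smul_right, mul_assoc, ← inner_conj_symm (u j) (e k), Complex.mul_conj,
      Complex.normSq_eq_norm_sq, ← Complex.ofReal_mul, Complex.ofReal_re, mul_comm]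
  -- These weights are doubly stochastic: the rows give Jensen's inequality for each `j`, the
  -- columns make the bounds add up to `∑ k, f (ρ k)`, so each Jensen inequality is an equality.
  have hrow : ∀ j, ∑ k, ‖⟪e k, u j⟫‖ ^ 2 = 1 := fun j => by
    rw [e.sum_sq_norm_inner_right]; simp
  have hcol : ∀ k, ∑ j, ‖⟪e k, u j⟫‖ ^ 2 = 1 := fun k => by
    rw [u.sum_sq_norm_inner_left]; simp
  have hle : ∀ j ∈ Finset.univ, f (⟪u j, R (u j)⟫).re ≤ ∑ k, ‖⟪e k, u j⟫‖ ^ 2 * f (ρ k) :=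
    fun j _ => by
      rw [hdiag]
      simpa using hf.convexOn.map_sum_le (t := Finset.univ) (fun k _ => by positivity) (hrow j)
        (fun k _ => Set.mem_univ (ρ k))
  have hsum : ∑ j, ∑ k, ‖⟪e k, u j⟫‖ ^ 2 * f (ρ k) = ∑ k, f (ρ k) := by
    rw [Finset.sum_comm]
    simp_rw [← Finset.sum_mul, hcol, one_mul]
  have heq := (Finset.sum_eq_sum_iff_of_le hle).1 (h.trans hsum.symm) j (Finset.mem_univ j)
  -- By strictness, every `ρ k` of nonzero weight equals the mean, so `u j` lies in one eigenspace
  -- of `R`.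
  have hJ := (hf.map_sum_eq_iff' (t := Finset.univ) (w := fun k => ‖⟪e k, u j⟫‖ ^ 2) (p := ρ)
    (fun k _ => by positivity) (hrow j) (fun k _ => Set.mem_univ _)).1
    (by simpa [hdiag] using heq)
  rw [hdiag]
  conv_rhs => arg 2; rw [← e.sum_repr' (u j)]
  rw [hR, Finset.smul_sum]
  refine Finset.sum_congr rfl fun k _ => ?_
  rw [smul_smul]
  by_cases hk : ⟪e k, u j⟫ = 0
  · simp [hk]
  · have := hJ k (Finset.mem_univ k) (by simpa using hk)
    rw [this]
    simp only [smul_eq_mul]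

/-- A diagonalizable operator is upper triangular in an orthonormal basis, with its eigenvalues on
the diagonal. -/
theorem exists_orthonormalBasis_triangular {k : ℕ} (M : E →ₗ[ℂ] E) (v : Module.Basis (Fin k) ℂ E)
    {μ : Fin k → ℂ} (hv : ∀ j, M (v j) = μ j • v j) :
    ∃ u : OrthonormalBasis (Fin k) ℂ E, ∀ i j, j ≤ i → ⟪u i, M (u j) - μ j • u j⟫ = 0 := by
  have hli := v.linearIndependent
  have hspan : ⊤ ≤ Submodule.span ℂ (Set.range (InnerProductSpace.gramSchmidtNormed ℂ v)) := by
    rw [InnerProductSpace.span_gramSchmidtNormed_range, InnerProductSpace.span_gramSchmidt,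
      v.span_eq]
  refine ⟨OrthonormalBasis.mk (InnerProductSpace.gramSchmidtNormed_orthonormal hli) hspan,
    fun i j hij => ?_⟩
  rw [OrthonormalBasis.coe_mk]
  set u := InnerProductSpace.gramSchmidtNormed ℂ v
  have horth : Orthonormal ℂ u := InnerProductSpace.gramSchmidtNormed_orthonormal hli
  have hmem : u j ∈ Submodule.span ℂ (v '' Set.Iic j) := by
    rw [← InnerProductSpace.span_gramSchmidt_Iic, ← InnerProductSpace.span_gramSchmidtNormed]
    exact Submodule.subset_span ⟨j, Set.self_mem_Iic, rfl⟩
  -- `M - μ j` lowers the flag spanned by the eigenvectors, and Gram–Schmidt preserves this flag.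
  have hlow : ∀ x ∈ Submodule.span ℂ (v '' Set.Iic j),
      M x - μ j • x ∈ Submodule.span ℂ (v '' Set.Iio j) := by
    intro x hx
    induction hx using Submodule.span_induction with
    | mem x hx =>
      obtain ⟨l, hl, rfl⟩ := hx
      rcases (Set.mem_Iic.1 hl).lt_or_eq with hl | rfl
      · rw [hv, ← sub_smul]
        exact Submodule.smul_mem _ _ (Submodule.subset_span ⟨l, hl, rfl⟩)
      · simp [hv]
    | zero => simp
    | add x y _ _ hx hy =>
      rw [map_add, smul_add, add_sub_add_comm]
      exact Submodule.add_mem _ hx hy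
    | smul a x _ hx =>
      rw [map_smul, smul_comm, ← smul_sub]
      exact Submodule.smul_mem _ _ hx
  replace hlow := hlow _ hmem
  rw [← InnerProductSpace.span_gramSchmidt_Iio, ← InnerProductSpace.span_gramSchmidtNormed] at hlow
  generalize M (u j) - μ j • u j = y at hlow
  induction hlow using Submodule.span_induction with
  | mem x hx =>
    obtain ⟨l, hl, rfl⟩ := hx
    exact horth.2 ((Set.mem_Iio.1 hl).trans_le hij).ne'
  | zero => simp
  | add x y _ _ hx hy => rw [inner_add_right, hx, hy, add_zero]
  | smul a x _ hx => rw [inner_smul_right, hx, mul_zero]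

/-- If an operator `M` is diagonalizable with real eigenvalues, and its real part has the same
strictly convex trace as `M`, then `M` is symmetric. -/
theorem isSymmetric_of_sum_convex_eq {k : ℕ} {κ : Type*} [Fintype κ] (M R : E →ₗ[ℂ] E)
    (v : Module.Basis (Fin k) ℂ E) {μ : Fin k → ℝ} (hv : ∀ j, M (v j) = (μ j : ℂ) • v j)
    (hR : ∀ x y, 2 * ⟪x, R y⟫ = ⟪x, M y⟫ + ⟪M x, y⟫)
    (e : OrthonormalBasis κ ℂ E) {ρ : κ → ℝ} (he : ∀ k, R (e k) = (ρ k : ℂ) • e k)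
    {f : ℝ → ℝ} (hf : StrictConvexOn ℝ Set.univ f) (h : ∑ j, f (μ j) = ∑ k, f (ρ k)) :
    M = R := by
  obtain ⟨u, hu⟩ := exists_orthonormalBasis_triangular M v hv
  have hu' : ∀ i j, j ≤ i → ⟪u i, M (u j)⟫ = μ j * ⟪u i, u j⟫ := fun i j hij => by
    rw [← inner_smul_right, ← sub_eq_zero, ← inner_sub_right, hu i j hij]
  have hdiag : ∀ j, ⟪u j, R (u j)⟫ = μ j := fun j => by
    have h1 := hR (u j) (u j)
    have h2 : ⟪u j, M (u j)⟫ = μ j := by simp [hu' j j le_rfl]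
    have h3 : ⟪M (u j), u j⟫ = μ j := by rw [← inner_conj_symm, h2, Complex.conj_ofReal]
    rw [h2, h3] at h1
    linear_combination h1 / 2
  have hRu : ∀ j, R (u j) = (μ j : ℂ) • u j := fun j => by
    have := apply_eq_smul_of_sum_convex_eq R u e he hf (by simpa [hdiag] using h) j
    simpa [hdiag] using this
  refine u.toBasis.ext fun j => ?_
  rw [u.coe_toBasis, hRu]
  refine InnerProductSpace.ext_inner_left_basis u.toBasis fun i => ?_
  rw [u.coe_toBasis, inner_smul_right]
  -- On and below the diagonal this is triangularity. Above it, the entry of `R` is zero and so is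
  -- the mirrored entry of `M`, which forces the entry of `M` to vanish.
  rcases le_or_gt j i with hij | hij
  · exact hu' i j hij
  · have h1 := hR (u i) (u j)
    have h2 : ⟪u i, u j⟫ = 0 := u.orthonormal.2 hij.ne
    have h3 : ⟪M (u i), u j⟫ = 0 := by
      rw [← inner_conj_symm, hu' j i hij.le, u.orthonormal.2 hij.ne', mul_zero, map_zero]
    rw [hRu, inner_smul_right, h2, h3] at h1
    rw [h2]
    simpa using h1.symm

end InnerProduct

/-! ### Commuting spherical isometries in finite dimension -/

section SphericalIsometry

variable {E : Type*} [NormedAddCommGroup E] [InnerProductSpace ℂ E] [FiniteDimensional ℂ E]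
  {ι : Type*}

local notation "⟪" x ", " y "⟫" => inner ℂ x y

/-- A commuting finite family of operators has a joint eigenvector in every nonzero common invariant
subspace. -/
theorem exists_joint_eigenvector [Fintype ι] (V : ι → Module.End ℂ E)
    (hV : ∀ i j, Commute (V i) (V j)) (K : Submodule ℂ E) (hK : K ≠ ⊥)
    (hinv : ∀ i, ∀ x ∈ K, V i x ∈ K) :
    ∃ x ∈ K, x ≠ 0 ∧ ∃ μ : ι → ℂ, ∀ i, V i x = μ i • x := by
  classical
  suffices H : ∀ s : Finset ι, ∃ L ≤ K, L ≠ ⊥ ∧ (∀ i, ∀ x ∈ L, V i x ∈ L) ∧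
      ∃ μ : ι → ℂ, ∀ i ∈ s, ∀ x ∈ L, V i x = μ i • x by
    obtain ⟨L, hLK, hL, -, μ, hμ⟩ := H Finset.univ
    obtain ⟨x, hx, hx0⟩ := L.ne_bot_iff.1 hL
    exact ⟨x, hLK hx, hx0, μ, fun i => hμ i (Finset.mem_univ i) x hx⟩
  intro s
  induction s using Finset.induction_on with
  | empty => exact ⟨K, le_rfl, hK, hinv, 0, by simp⟩
  | insert a s ha ih =>
    obtain ⟨L, hLK, hL, hLinv, μ, hμ⟩ := ih
    have : Nontrivial L := (Submodule.nontrivial_iff_ne_bot).2 hL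
    obtain ⟨c, hc⟩ := Module.End.exists_eigenvalue ((V a).restrict (hLinv a))
    obtain ⟨y, hy⟩ := hc.exists_hasEigenvector
    have hya : V a y = c • (y : E) := congrArg Subtype.val hy.apply_eq_smul
    refine ⟨L ⊓ (V a).eigenspace c, inf_le_left.trans hLK, ?_, ?_, Function.update μ a c, ?_⟩
    · exact (Submodule.ne_bot_iff _).2
        ⟨y, ⟨y.2, Module.End.mem_eigenspace_iff.2 hya⟩, by simpa using hy.2⟩
    · rintro i x ⟨hx, hxa⟩
      refine ⟨hLinv i x hx, Module.End.mem_eigenspace_iff.2 ?_⟩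
      rw [← Module.End.mul_apply, (hV a i).eq, Module.End.mul_apply,
        Module.End.mem_eigenspace_iff.1 hxa, map_smul]
    · rintro i hi x ⟨hx, hxa⟩
      by_cases hia : i = a
      · subst hia
        simpa using Module.End.mem_eigenspace_iff.1 hxa
      · rw [Function.update_of_ne hia]
        exact hμ i (Finset.mem_of_mem_insert_of_ne hi hia) x hx

variable [Fintype ι] {V : ι → Module.End ℂ E}

/-- The joint eigenspaces of a commuting spherical isometry are invariant under the adjoints. -/
theorem apply_adjoint_eq_smul_of_sphericalIsometry (hV : ∀ i j, Commute (V i) (V j))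
    (hiso : ∀ x, ∑ i, ‖V i x‖ ^ 2 = ‖x‖ ^ 2) {e : E} {μ : ι → ℂ} (he : ∀ i, V i e = μ i • e)
    (i j : ι) :
    V i (LinearMap.adjoint (V j) e) = μ i • LinearMap.adjoint (V j) e := by
  rcases eq_or_ne e 0 with rfl | he0
  · simp
  have hμ : ∑ i, ‖μ i‖ ^ 2 = 1 := by
    have h := hiso e
    simp_rw [he, norm_smul, mul_pow, ← Finset.sum_mul] at h
    exact mul_right_cancel₀ (pow_ne_zero 2 (norm_ne_zero_iff.2 he0)) (by rw [h, one_mul])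
  -- `W` fixes `e`, and by the identity below with `x = y`, a fixed vector of `W*` is a joint
  -- eigenvector for `μ`. Since `W*` commutes with each `V j*`, it is enough that `W*` fixes `e`.
  set W : Module.End ℂ E := ∑ i, (starRingEnd ℂ) (μ i) • V i with hW
  have hkey : ∀ x y, ∑ i, ‖V i x - μ i • y‖ ^ 2 = ‖x‖ ^ 2 + ‖y‖ ^ 2 - 2 * (⟪y, W x⟫).re := by
    intro x y
    have h1 : ⟪y, W x⟫ = ∑ i, ⟪μ i • y, V i x⟫ := by
      simp [hW, LinearMap.sum_apply, mul_comm]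
    have h2 : ∀ i, ‖V i x - μ i • y‖ ^ 2 =
        ‖V i x‖ ^ 2 - 2 * (⟪μ i • y, V i x⟫).re + ‖μ i‖ ^ 2 * ‖y‖ ^ 2 := fun i => by
      rw [@norm_sub_sq ℂ, norm_smul, mul_pow, inner_re_symm]
      rfl
    simp_rw [h2, Finset.sum_add_distrib, Finset.sum_sub_distrib, ← Finset.mul_sum, ← Finset.sum_mul]
    rw [hiso, hμ, h1, Complex.re_sum]
    ring
  have hre : ∀ x : E, (⟪x, x⟫).re = ‖x‖ ^ 2 := fun x => inner_self_eq_norm_sq (𝕜 := ℂ) x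
  have hfix : ∀ x, LinearMap.adjoint W x = x → ∀ i, V i x = μ i • x := by
    intro x hx i
    have h := hkey x x
    rw [← LinearMap.adjoint_inner_left, hx, hre] at h
    have h0 : ∑ i, ‖V i x - μ i • x‖ ^ 2 = 0 := by
      rw [h]; ring
    have := (Finset.sum_eq_zero_iff_of_nonneg (fun i _ => by positivity)).1 h0 i (Finset.mem_univ i)
    exact sub_eq_zero.1 (by simpa using this)
  have hWe : W e = e := by
    have h1 : ∀ i, (starRingEnd ℂ) (μ i) • μ i • e = ((‖μ i‖ ^ 2 : ℝ) : ℂ) • e := fun i => by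
      rw [smul_smul, ← Complex.normSq_eq_norm_sq, ← Complex.normSq_eq_conj_mul_self]
    simp only [hW, LinearMap.sum_apply, LinearMap.smul_apply, he, h1]
    rw [← Finset.sum_smul, ← Complex.ofReal_sum, hμ, Complex.ofReal_one, one_smul]
  -- The identity at `x = W* e`, `y = e` gives `‖W* e‖ ≤ ‖e‖`, while `W e = e` gives `‖W* e - e‖² =
  -- ‖W* e‖² - ‖e‖²`.
  have hWe' : LinearMap.adjoint W e = e := by
    set z := LinearMap.adjoint W e
    have h1 : (⟪e, W z⟫).re = ‖z‖ ^ 2 := by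
      rw [← LinearMap.adjoint_inner_left, hre]
    have h2 : 0 ≤ ‖z‖ ^ 2 + ‖e‖ ^ 2 - 2 * (⟪e, W z⟫).re := by
      rw [← hkey]; positivity
    have h3 : ‖z - e‖ ^ 2 = ‖z‖ ^ 2 - 2 * ‖e‖ ^ 2 + ‖e‖ ^ 2 := by
      rw [@norm_sub_sq ℂ, LinearMap.adjoint_inner_left, hWe]
      exact congrArg (fun r => ‖z‖ ^ 2 - 2 * r + ‖e‖ ^ 2) (hre e)
    have h4 : ‖z - e‖ ^ 2 = 0 := le_antisymm (by linarith) (by positivity)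
    exact sub_eq_zero.1 (by simpa using h4)
  refine hfix _ ?_ i
  have hc : Commute W (V j) := by
    rw [hW]
    exact Commute.sum_left _ _ _ fun i _ => (hV i j).smul_left _
  have hc' : LinearMap.adjoint W * LinearMap.adjoint (V j) =
      LinearMap.adjoint (V j) * LinearMap.adjoint W := by
    rw [← LinearMap.star_eq_adjoint, ← LinearMap.star_eq_adjoint, ← star_mul, ← star_mul, hc.eq]
  rw [← Module.End.mul_apply, hc', Module.End.mul_apply, hWe']

/-- A commuting spherical isometry on a finite-dimensional space consists of normal operators. -/
theorem commute_adjoint_of_sphericalIsometry (hV : ∀ i j, Commute (V i) (V j))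
    (hiso : ∀ x, ∑ i, ‖V i x‖ ^ 2 = ‖x‖ ^ 2) (j : ι) :
    Commute (LinearMap.adjoint (V j)) (V j) := by
  set S : Set E := {x | ∃ μ : ι → ℂ, ∀ i, V i x = μ i • x}
  -- The span of the joint eigenvectors is invariant under the adjoints, so its complement is
  -- invariant under `V` and, if nonzero, would contain a joint eigenvector.
  have htop : Submodule.span ℂ S = ⊤ := by
    rw [← Submodule.orthogonal_eq_bot_iff]
    by_contra hne
    obtain ⟨x, hx, hx0, hμ⟩ := exists_joint_eigenvector V hV _ hne fun i x hx => by
      rw [Submodule.mem_orthogonal] at hx ⊢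
      intro y hy
      rw [← LinearMap.adjoint_inner_left]
      refine hx _ ?_
      refine Submodule.span_induction (p := fun y _ => LinearMap.adjoint (V i) y ∈
        Submodule.span ℂ S) ?_ (by simp) ?_ ?_ hy
      · rintro e ⟨μ, he⟩
        exact Submodule.subset_span
          ⟨μ, fun l => apply_adjoint_eq_smul_of_sphericalIsometry hV hiso he l i⟩
      · intro a b _ _ ha hb
        rw [map_add]
        exact Submodule.add_mem _ ha hb
      · intro c a _ ha
        rw [map_smul]
        exact Submodule.smul_mem _ _ ha
    have := (Submodule.mem_orthogonal _ _).1 hx x (Submodule.subset_span hμ)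
    exact hx0 (inner_self_eq_zero.1 this)
  refine LinearMap.ext_on htop ?_
  rintro e ⟨μ, he⟩
  rw [Module.End.mul_apply, Module.End.mul_apply, he,
    apply_adjoint_eq_smul_of_sphericalIsometry hV hiso he j j, map_smul]

end SphericalIsometry

open Matrix

/-! ### Eigenvalue sums of Hermitian matrices -/

section Traces

variable {m l : Type*} [Fintype m] [DecidableEq m] [Fintype l] [DecidableEq l]

theorem Matrix.IsHermitian.trace_cfc {A : Matrix m m ℂ} (hA : A.IsHermitian) (f : ℝ → ℝ) :
    (cfc f A).trace = ∑ i, (f (hA.eigenvalues i) : ℂ) := by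
  rw [hA.cfc_eq, IsHermitian.cfc, Unitary.conjStarAlgAut_apply, trace_mul_comm, ← mul_assoc]
  simp [trace_diagonal]

theorem Matrix.IsHermitian.trace_pow {A : Matrix m m ℂ} (hA : A.IsHermitian) (k : ℕ) :
    (A ^ k).trace = ∑ i, ((hA.eigenvalues i ^ k : ℝ) : ℂ) := by
  rw [← hA.trace_cfc (fun x => x ^ k)]
  exact congrArg trace (cfc_pow_id (R := ℝ) A k hA).symm

/-- If the even moments of two Hermitian matrices are proportional, so are their absolute
moments. -/
theorem Matrix.IsHermitian.sum_abs_eigenvalues_rpow_eq {A : Matrix m m ℂ} {B : Matrix l l ℂ}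
    (hA : A.IsHermitian) (hB : B.IsHermitian) (c : ℝ)
    (h : ∀ k, (A ^ (2 * (k + 1))).trace = c * (B ^ (2 * (k + 1))).trace) {p : ℝ} (hp : 0 < p) :
    ∑ i, |hA.eigenvalues i| ^ p = c * ∑ i, |hB.eigenvalues i| ^ p := by
  classical
  have hpow : ∀ k, ∑ i, (hA.eigenvalues i ^ 2) ^ (k + 1) =
      c * ∑ i, (hB.eigenvalues i ^ 2) ^ (k + 1) := fun k => by
    have := h k
    rw [hA.trace_pow, hB.trace_pow] at this
    simp_rw [← pow_mul]
    exact_mod_cast this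
  -- The extra node `0` kills the constant term of the interpolant of `x ^ (p / 2)`: the zeroth
  -- moments, which are the sizes of the matrices, need not be proportional.
  set s : Finset ℝ := insert 0 (Finset.univ.image (fun i => hA.eigenvalues i ^ 2) ∪
    Finset.univ.image (fun i => hB.eigenvalues i ^ 2)) with hs
  set q := Lagrange.interpolate s id (fun x : ℝ => x ^ (p / 2)) with hq
  have hnode : ∀ x ∈ s, q.eval x = x ^ (p / 2) := fun x hx =>
    Lagrange.eval_interpolate_at_node _ (Set.injOn_id _) hx
  have hq0 : q.coeff 0 = 0 := by
    rw [Polynomial.coeff_zero_eq_eval_zero, hnode 0 (by simp [hs]), Real.zero_rpow (by positivity)]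
  have hsq : ∀ x : ℝ, x ^ 2 ∈ s → |x| ^ p = q.eval (x ^ 2) := fun x hx => by
    rw [hnode _ hx, ← sq_abs, ← Real.rpow_natCast, ← Real.rpow_mul (abs_nonneg x)]
    congr 1
    push_cast
    ring
  rw [Finset.sum_congr rfl fun i _ => hsq _ (by simp [hs]),
    Finset.sum_congr rfl fun i _ => hsq (hB.eigenvalues i) (by simp [hs])]
  simp_rw [Polynomial.eval_eq_sum_range]
  rw [Finset.sum_comm, Finset.sum_comm (s := Finset.univ (α := l)), Finset.mul_sum]
  refine Finset.sum_congr rfl fun k _ => ?_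
  rw [← Finset.mul_sum, ← Finset.mul_sum]
  rcases k with _ | k
  · simp [hq0]
  · rw [hpow]
    ring

/-- If `N` is Hermitian, `M` is similar to `N` and the real part `R` of `M` has the same strictly
convex trace as `N`, then `M` is Hermitian. -/
theorem Matrix.eq_of_similar_of_sum_convex_eq {N R M C D : Matrix m m ℂ} (hN : N.IsHermitian)
    (hR : R.IsHermitian) (hCD : C * D = 1) (hDC : D * C = 1) (hM : M = C * N * D)
    (hMR : (2 : ℂ) • R = M + Mᴴ) {f : ℝ → ℝ} (hf : StrictConvexOn ℝ Set.univ f)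
    (h : ∑ i, f (hN.eigenvalues i) = ∑ i, f (hR.eigenvalues i)) : M = R := by
  have heig : ∀ {A : Matrix m m ℂ} (hA : A.IsHermitian) (i : m),
      A.toEuclideanLin (hA.eigenvectorBasis i) =
        (hA.eigenvalues i : ℂ) • hA.eigenvectorBasis i := fun hA i => by
    apply WithLp.ofLp_injective
    simpa using hA.mulVec_eigenvectorBasis i
  let L : EuclideanSpace ℂ m ≃ₗ[ℂ] EuclideanSpace ℂ m :=
    LinearEquiv.ofLinearMap C.toEuclideanLin D.toEuclideanLin
      (by rw [← toLpLin_mul_same, hCD, toLpLin_one]) (by rw [← toLpLin_mul_same, hDC, toLpLin_one])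
  have hMC : M * C = C * N := by rw [hM, mul_assoc, hDC, mul_one]
  -- `C` carries eigenvectors of `N` to a basis of eigenvectors of `M`, in general not orthogonal.
  let v := (hN.eigenvectorBasis.toBasis.map L).reindex (Fintype.equivFin m)
  refine toEuclideanLin.injective (isSymmetric_of_sum_convex_eq _ _ v
    (μ := fun j => hN.eigenvalues ((Fintype.equivFin m).symm j)) (fun j => ?_) (fun x y => ?_)
    hR.eigenvectorBasis (heig hR) hf ?_)
  · have : v j = C.toEuclideanLin (hN.eigenvectorBasis ((Fintype.equivFin m).symm j)) := by
      simp [v, L]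
    rw [this, ← LinearMap.comp_apply, ← toLpLin_mul_same, hMC, toLpLin_mul_same,
      LinearMap.comp_apply, heig, map_smul]
  · rw [← LinearMap.adjoint_inner_right, ← toEuclideanLin_conjTranspose_eq_adjoint,
      ← inner_add_right, ← LinearMap.add_apply, ← map_add, ← hMR, map_smul, LinearMap.smul_apply,
      inner_smul_right]
  · rw [← h]
    exact Equiv.sum_comp (Fintype.equivFin m).symm fun i => f (hN.eigenvalues i)

end Traces

/-! ### Normal matrices -/

section Normality

variable {n d : ℕ}

/-- A commuting tuple of matrices with `∑ i, V i* V i = 1` consists of normal matrices. -/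
theorem isStarNormal_of_sum_star_mul_self_eq_one {V : Fin d → Matrix (Fin n) (Fin n) ℂ}
    (hV : ∀ i j, Commute (V i) (V j)) (h1 : ∑ i, star (V i) * V i = 1) (j : Fin d) :
    IsStarNormal (V j) := by
  have hc := commute_adjoint_of_sphericalIsometry (V := fun i => (V i).toEuclideanLin)
    (fun i j => by
      rw [Commute, SemiconjBy, Module.End.mul_eq_comp, Module.End.mul_eq_comp, ← toLpLin_mul_same,
        ← toLpLin_mul_same, (hV i j).eq])
    (fun x => by
      have hsum : ∑ i, inner ℂ ((V i).toEuclideanLin x) ((V i).toEuclideanLin x) =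
          inner ℂ x x := by
        simp_rw [← LinearMap.adjoint_inner_right, ← toEuclideanLin_conjTranspose_eq_adjoint]
        rw [← inner_sum]
        congr 1
        simp_rw [← LinearMap.comp_apply, ← toLpLin_mul_same]
        rw [← LinearMap.sum_apply, ← map_sum]
        simp only [← star_eq_conjTranspose, h1, toLpLin_one, LinearMap.id_apply]
      simp_rw [inner_self_eq_norm_sq_to_K] at hsum
      exact_mod_cast hsum) j
  rw [← toEuclideanLin_conjTranspose_eq_adjoint, Commute, SemiconjBy, Module.End.mul_eq_comp,
    Module.End.mul_eq_comp, ← toLpLin_mul_same, ← toLpLin_mul_same] at hc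
  exact ⟨toEuclideanLin.injective hc⟩

-- Fuglede's theorem, with the operator norm making the matrices a C*-algebra.
open scoped Matrix.Norms.L2Operator in
theorem commute_star_of_isStarNormal {m : Type*} [Fintype m] [DecidableEq m] {A B : Matrix m m ℂ}
    (hA : IsStarNormal A) (h : Commute A B) : Commute (star A) B :=
  hA.commute_star_left h

end Normality

/-! ### Self-adjoint dilations and the Schatten norm -/

namespace SphericalTuple

variable {n d : ℕ}

/-- The tuple `S` as a single operator from `ℂⁿ` to the sum of `d` copies of `ℂⁿ`. -/
def column (S : Fin d → Matrix (Fin n) (Fin n) ℂ) : Matrix (Fin n × Fin d) (Fin n) ℂ :=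
  .of fun x b => S x.2 x.1 b

theorem column_injective :
    Function.Injective (column : (Fin d → Matrix (Fin n) (Fin n) ℂ) → _) := fun S S' h => by
  funext i
  ext a b
  exact congrFun (congrFun h (a, i)) b

theorem conjTranspose_column_mul_column (S S' : Fin d → Matrix (Fin n) (Fin n) ℂ) :
    (column S)ᴴ * column S' = ∑ i, star (S i) * S' i := by
  ext a b
  simp only [mul_apply, conjTranspose_apply, column, of_apply, Fintype.sum_prod_type,
    Matrix.sum_apply, star_eq_conjTranspose]
  exact Finset.sum_comm

theorem blockDiagonal_mul_column_mul (A B : Matrix (Fin n) (Fin n) ℂ)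
    (S : Fin d → Matrix (Fin n) (Fin n) ℂ) :
    blockDiagonal (fun _ : Fin d => A) * column S * B = column fun i => A * S i * B := by
  have h1 : blockDiagonal (fun _ : Fin d => A) * column S = column fun i => A * S i := by
    ext ⟨a, i⟩ b
    simp [mul_apply, column, blockDiagonal_apply, Fintype.sum_prod_type]
  rw [h1]
  ext ⟨a, i⟩ b
  simp [mul_apply, column]

/-- The self-adjoint dilation of a tuple, generalized to a pair of tuples. -/
def dilation (X Y : Fin d → Matrix (Fin n) (Fin n) ℂ) :
    Matrix (Fin n ⊕ Fin n × Fin d) (Fin n ⊕ Fin n × Fin d) ℂ :=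
  fromBlocks 0 (column X)ᴴ (column Y) 0

/-- The amplification of a matrix to the space of the dilation. -/
def amplify (d : ℕ) (A : Matrix (Fin n) (Fin n) ℂ) :
    Matrix (Fin n ⊕ Fin n × Fin d) (Fin n ⊕ Fin n × Fin d) ℂ :=
  fromBlocks A 0 0 (blockDiagonal fun _ => A)

theorem amplify_mul_amplify {A B : Matrix (Fin n) (Fin n) ℂ} (h : A * B = 1) :
    amplify d A * amplify d B = 1 := by
  rw [amplify, amplify, fromBlocks_multiply, ← blockDiagonal_mul]
  simp only [h, Matrix.mul_zero, Matrix.zero_mul, add_zero, zero_add]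
  rw [← Pi.one_def, blockDiagonal_one, fromBlocks_one]

/-- For `A = P^s` and `B = P^{-s}` this is a similarity that shifts the exponents of `P` in the two
off-diagonal blocks in opposite directions. -/
theorem amplify_mul_dilation_mul_amplify {A B : Matrix (Fin n) (Fin n) ℂ} (hA : A.IsHermitian)
    (hB : B.IsHermitian) (X Y : Fin d → Matrix (Fin n) (Fin n) ℂ) :
    amplify d A * dilation X Y * amplify d B =
      dilation (fun i => B * X i * A) (fun i => A * Y i * B) := by
  have hX : A * (column X)ᴴ * blockDiagonal (fun _ : Fin d => B) =
      (column fun i => B * X i * A)ᴴ := by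
    rw [← blockDiagonal_mul_column_mul, conjTranspose_mul, conjTranspose_mul,
      blockDiagonal_conjTranspose, hA.eq, hB.eq, Matrix.mul_assoc]
  rw [amplify, amplify, dilation, dilation, fromBlocks_multiply, fromBlocks_multiply, ← hX,
    ← blockDiagonal_mul_column_mul]
  simp

theorem conjTranspose_dilation (X Y : Fin d → Matrix (Fin n) (Fin n) ℂ) :
    (dilation X Y)ᴴ = dilation Y X := by
  simp [dilation, fromBlocks_conjTranspose]

theorem isHermitian_dilation (S : Fin d → Matrix (Fin n) (Fin n) ℂ) :
    (dilation S S).IsHermitian :=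
  conjTranspose_dilation S S

theorem isHermitian_modulus (S : Fin d → Matrix (Fin n) (Fin n) ℂ) : (modulus S).IsHermitian :=
  IsSelfAdjoint.of_nonneg (modulus_nonneg S)

/-- The square of the dilation has diagonal blocks `S*S` and `SS*`, whose positive powers have equal
traces. The zeroth power is excluded because the blocks differ in size. -/
theorem trace_dilation_pow (S : Fin d → Matrix (Fin n) (Fin n) ℂ) (k : ℕ) :
    (dilation S S ^ (2 * (k + 1))).trace = 2 * (modulus S ^ (2 * (k + 1))).trace := by
  have hcol : ∀ k : ℕ, (column S * (column S)ᴴ) ^ (k + 1) =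
      column S * ((column S)ᴴ * column S) ^ k * (column S)ᴴ := fun k => by
    induction k with
    | zero => simp
    | succ k ih => rw [pow_succ, ih, pow_succ]; simp only [Matrix.mul_assoc]
  have hsq : dilation S S ^ 2 =
      fromBlocks ((column S)ᴴ * column S) 0 0 (column S * (column S)ᴴ) := by
    rw [sq, dilation, fromBlocks_multiply]
    simp
  have htr : ∀ (A : Matrix (Fin n) (Fin n) ℂ) (B : Matrix (Fin n × Fin d) (Fin n × Fin d) ℂ),
      (fromBlocks A 0 0 B).trace = A.trace + B.trace := fun A B => by
    simp [trace, Fintype.sum_sum_type]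
  rw [pow_mul, hsq, fromBlocks_diagonal_pow, htr, hcol, trace_mul_comm (_ * _),
    ← Matrix.mul_assoc, ← pow_succ', pow_mul, sq (modulus S), modulus_mul_self,
    conjTranspose_column_mul_column, two_mul]

theorem eigenvalues_modulus_nonneg (S : Fin d → Matrix (Fin n) (Fin n) ℂ) (i : Fin n) :
    0 ≤ (isHermitian_modulus S).eigenvalues i :=
  (Matrix.nonneg_iff_posSemidef.1 (modulus_nonneg S)).eigenvalues_nonneg i

theorem re_trace_modulus_rpow (S : Fin d → Matrix (Fin n) (Fin n) ℂ) (p : ℝ) :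
    (modulus S ^ p).trace.re = ∑ i, |(isHermitian_modulus S).eigenvalues i| ^ p := by
  rw [CFC.rpow_eq_cfc_real (modulus_nonneg S), (isHermitian_modulus S).trace_cfc]
  simp [abs_of_nonneg (eigenvalues_modulus_nonneg S _)]

theorem schattenNorm_eq_iff (S S' : Fin d → Matrix (Fin n) (Fin n) ℂ) {p : ℝ} (hp : 0 < p) :
    schattenNorm p S = schattenNorm p S' ↔
      ∑ i, |(isHermitian_dilation S).eigenvalues i| ^ p =
        ∑ i, |(isHermitian_dilation S').eigenvalues i| ^ p := by
  have h : ∀ S : Fin d → Matrix (Fin n) (Fin n) ℂ,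
      ∑ i, |(isHermitian_dilation S).eigenvalues i| ^ p = 2 * (modulus S ^ p).trace.re :=
    fun S => by
      rw [re_trace_modulus_rpow]
      exact (isHermitian_dilation S).sum_abs_eigenvalues_rpow_eq (isHermitian_modulus S) 2
        (fun k => by rw [trace_dilation_pow]; norm_num) hp
  have hnn : ∀ S : Fin d → Matrix (Fin n) (Fin n) ℂ, 0 ≤ (modulus S ^ p).trace.re := fun S => by
    rw [re_trace_modulus_rpow]
    positivity
  rw [h, h, schattenNorm, schattenNorm, Real.rpow_left_inj (hnn S) (hnn S') (by positivity),
    mul_right_inj' two_ne_zero]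

/-- A vector in the kernel of `P` is killed by every `T i`, hence by the first Koszul map, which is
injective. -/
theorem isUnit_modulus_of_isTaylorInvertible {T : Fin d → Matrix (Fin n) (Fin n) ℂ}
    (hT : IsTaylorInvertible T) : IsUnit (modulus T) := by
  rw [← mulVec_injective_iff_isUnit, ← coe_mulVecLin, injective_iff_map_eq_zero]
  intro x hx
  rw [mulVecLin_apply] at hx
  have hTx : ∀ i, (T i).mulVec x = 0 := fun i => by
    rw [← polarPart_mul_modulus T i, ← mulVec_mulVec, hx, mulVec_zero]
  have h0 : koszulD T 0 (fun _ => x) = koszulD T 0 0 := by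
    rw [map_zero]
    funext s
    simp [koszulD, hTx]
  exact congrFun (hT.1 h0) ⟨∅, rfl⟩

/-! ### The equality case and normality -/

variable {T : Fin d → Matrix (Fin n) (Fin n) ℂ}

theorem isHermitian_modulus_rpow (T : Fin d → Matrix (Fin n) (Fin n) ℂ) (t : ℝ) :
    (modulus T ^ t).IsHermitian :=
  IsSelfAdjoint.of_nonneg CFC.rpow_nonneg

theorem sum_star_polarPart_mul_self (hP : IsUnit (modulus T)) :
    ∑ i, star (polarPart T i) * polarPart T i = 1 := by
  obtain ⟨⟨hid, -⟩, hker⟩ := isStarProjection_polarPart T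
  refine (IsIdempotentElem.iff_eq_one_of_isUnit ?_).1 hid
  rw [← mulVec_injective_iff_isUnit, ← coe_mulVecLin, injective_iff_map_eq_zero]
  intro x hx
  refine mulVec_injective_iff_isUnit.2 hP ?_
  rw [mulVec_zero]
  exact (hker x).1 hx

/-- The equality case of the Heinz inequality: `P` commutes with the polar part. -/
theorem commute_polarPart_modulus {p t : ℝ} (hp : 1 < p) (ht : t ≠ 1 / 2)
    (hP : IsUnit (modulus T)) (h : schattenNorm p (aluthge T) = schattenNorm p (heinz T t))
    (i : Fin d) : Commute (polarPart T i) (modulus T) := by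
  have hpos : IsStrictlyPositive (modulus T) := hP.isStrictlyPositive (modulus_nonneg T)
  have hadd : ∀ x y : ℝ, modulus T ^ x * modulus T ^ y = modulus T ^ (x + y) := fun x y =>
    (CFC.rpow_add hP).symm
  have hinv : ∀ x : ℝ, modulus T ^ x * modulus T ^ (-x) = 1 := fun x =>
    CFC.rpow_mul_rpow_neg x hpos
  have hinv' : ∀ x : ℝ, modulus T ^ (-x) * modulus T ^ x = 1 := fun x =>
    CFC.rpow_neg_mul_rpow x hpos
  have hH := isHermitian_modulus_rpow T
  have hsim : dilation (genAluthge T (1 - t)) (genAluthge T t) =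
      amplify d (modulus T ^ (t - 1 / 2)) * dilation (aluthge T) (aluthge T) *
        amplify d (modulus T ^ (-(t - 1 / 2))) := by
    rw [amplify_mul_dilation_mul_amplify (hH _) (hH _)]
    congr 1 <;> funext j <;> simp only [genAluthge, aluthge]
    · rw [← mul_assoc, ← mul_assoc, hadd, mul_assoc _ (_ ^ _) (_ ^ _), hadd]
      rw [sub_sub_cancel, add_sub_cancel, show -(t - 1 / 2) + 1 / 2 = 1 - t by ring]
    · rw [← mul_assoc, ← mul_assoc, hadd, mul_assoc _ (_ ^ _) (_ ^ _), hadd]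
      rw [sub_add_cancel, show 1 / 2 + -(t - 1 / 2) = 1 - t by ring]
  have hreal : (2 : ℂ) • dilation (heinz T t) (heinz T t) =
      dilation (genAluthge T (1 - t)) (genAluthge T t) +
        (dilation (genAluthge T (1 - t)) (genAluthge T t))ᴴ := by
    rw [conjTranspose_dilation]
    ext (a | ⟨a, j⟩) (b | ⟨b, l⟩) <;>
      simp [dilation, column, heinz]
    ring
  have hM := eq_of_similar_of_sum_convex_eq (isHermitian_dilation _) (isHermitian_dilation _)
    (amplify_mul_amplify (hinv _)) (amplify_mul_amplify (hinv' _)) hsim hreal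
    (strictConvexOn_abs_rpow hp) ((schattenNorm_eq_iff _ _ (by linarith)).1 h)
  have hblocks := fromBlocks_inj.1 hM
  have hX : genAluthge T (1 - t) = heinz T t :=
    column_injective (conjTranspose_injective hblocks.2.1)
  have hY : genAluthge T t = heinz T t := column_injective hblocks.2.2.1
  have hXY := congrFun (hY.trans hX.symm) i
  simp only [genAluthge, sub_sub_cancel] at hXY
  -- Multiply `P^t V P^{1-t} = P^{1-t} V P^t` by `P^{-(1-t)}` on both sides.
  have hcomm : Commute (polarPart T i) (modulus T ^ (2 * t - 1)) := by
    have h1 := congrArg (fun A => modulus T ^ (-(1 - t)) * A * modulus T ^ (-(1 - t))) hXY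
    simp only [← mul_assoc, hadd] at h1
    simp only [mul_assoc, hadd] at h1
    rw [show -(1 - t) + t = 2 * t - 1 by ring, show t + -(1 - t) = 2 * t - 1 by ring,
      add_neg_cancel, neg_add_cancel, CFC.rpow_zero _ (modulus_nonneg T), one_mul, mul_one] at h1
    exact h1.symm
  -- Since `t ≠ 1/2`, `P` is recovered as a power of `P^{2t-1}`.
  have ht' : 2 * t - 1 ≠ 0 := fun h0 => ht (by linarith)
  rw [← CFC.rpow_rpow_inv (modulus T) (2 * t - 1) ht' hpos,
    CFC.rpow_eq_cfc_real (a := modulus T ^ (2 * t - 1)) CFC.rpow_nonneg]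
  exact (hcomm.symm.cfc_real _).symm

/-- A commuting tuple with invertible modulus is normal if the modulus commutes with the polar
part. -/
theorem isNormal_of_commute_polarPart_modulus (hcomm : IsCommuting T) (hP : IsUnit (modulus T))
    (h : ∀ i, Commute (polarPart T i) (modulus T)) : IsNormal T := by
  have hT : ∀ i, T i = polarPart T i * modulus T := fun i => (polarPart_mul_modulus T i).symm
  have hV : ∀ i j, Commute (polarPart T i) (polarPart T j) := fun i j => by
    -- The invertible factor `P²` cancels from `T i * T j = T j * T i`.
    have h2 : ∀ i j, T i * T j = polarPart T i * polarPart T j * (modulus T * modulus T) :=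
      fun i j => by
        conv_lhs => rw [hT i, hT j]
        rw [mul_assoc, ← mul_assoc (modulus T), ← (h j).eq]
        simp only [mul_assoc]
    have h3 := hcomm i j
    rw [h2, h2] at h3
    exact (hP.mul hP).mul_right_cancel h3
  refine ⟨hcomm, fun i => ⟨?_⟩⟩
  have hN := isStarNormal_of_sum_star_mul_self_eq_one hV (sum_star_polarPart_mul_self hP) i
  have hPs : star (modulus T) = modulus T := (modulus_pinv T).1
  have hs : Commute (star (polarPart T i)) (modulus T) := by
    have := (h i).star_star
    rwa [hPs] at this
  have h4 : Commute (modulus T * star (polarPart T i)) (polarPart T i * modulus T) :=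
    ((h i).symm.mul_right (Commute.refl _)).mul_left (hN.star_comm_self.mul_right hs)
  rw [hT i, star_mul, hPs]
  exact h4

/-- By Fuglede, `P²` commutes with each `T i`; hence so does `P`, which therefore commutes with `V`,
and the powers of `P` recombine to `P`. -/
theorem genAluthge_eq_of_isNormal (hT : IsNormal T) (hP : IsUnit (modulus T)) (t : ℝ) :
    genAluthge T t = T := by
  funext i
  have hc : Commute (∑ j, star (T j) * T j) (T i) :=
    Commute.sum_left _ _ _ fun j _ =>
      (commute_star_of_isStarNormal (hT.2 j) (hT.1 j i)).mul_left (hT.1 j i)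
  have hPT : Commute (modulus T) (T i) := by
    rw [modulus, CFC.sqrt_eq_cfc]
    exact hc.cfc_nnreal _
  have hPV : Commute (modulus T) (polarPart T i) :=
    hPT.mul_right ((Commute.refl (modulus T)).cfc_real _).symm
  have hPtV : Commute (modulus T ^ t) (polarPart T i) := by
    rw [CFC.rpow_eq_cfc_real (modulus_nonneg T)]
    exact hPV.cfc_real _
  rw [genAluthge, hPtV.eq, mul_assoc, ← CFC.rpow_add hP, add_sub_cancel,
    CFC.rpow_one _ (modulus_nonneg T), polarPart_mul_modulus]

theorem aluthge_eq_heinz_of_isNormal (hT : IsNormal T) (hP : IsUnit (modulus T)) (t : ℝ) :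
    aluthge T = heinz T t := by
  have h1 : aluthge T = genAluthge T (1 / 2) := by
    funext i
    rw [aluthge, genAluthge]
    norm_num
  funext i
  rw [h1, heinz, genAluthge_eq_of_isNormal hT hP, genAluthge_eq_of_isNormal hT hP,
    genAluthge_eq_of_isNormal hT hP, ← two_smul ℂ, smul_smul]
  norm_num

end SphericalTuple

open SphericalTuple in
theorem theorem3p14 (n d : ℕ) (p : ℝ) (hp : 1 < p) (T : Fin d → Matrix (Fin n) (Fin n) ℂ)
    (hcomm : IsCommuting T) (hT : IsTaylorInvertible T) :
    ((∃ t : ℝ, 0 < t ∧ t < 1 ∧ t ≠ 1 / 2 ∧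
        schattenNorm p (aluthge T) = schattenNorm p (heinz T t)) ↔ IsNormal T) ∧
      ((∀ t : ℝ, 0 < t → t < 1 → t ≠ 1 / 2 →
        schattenNorm p (aluthge T) = schattenNorm p (heinz T t)) ↔ IsNormal T) := by
  have hP := isUnit_modulus_of_isTaylorInvertible hT
  have hnormal : ∀ t : ℝ, t ≠ 1 / 2 →
      schattenNorm p (aluthge T) = schattenNorm p (heinz T t) → IsNormal T := fun t ht h =>
    isNormal_of_commute_polarPart_modulus hcomm hP (commute_polarPart_modulus hp ht hP h)
  have hnorm : IsNormal T → ∀ t : ℝ, schattenNorm p (aluthge T) = schattenNorm p (heinz T t) :=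
    fun hN t => by rw [aluthge_eq_heinz_of_isNormal hN hP t]
  refine ⟨⟨fun ⟨t, _, _, ht, h⟩ => hnormal t ht h, fun hN =>
    ⟨1 / 4, by norm_num, by norm_num, by norm_num, hnorm hN _⟩⟩, fun h => ?_,
    fun hN t _ _ _ => hnorm hN t⟩
  exact hnormal (1 / 4) (by norm_num) (h _ (by norm_num) (by norm_num) (by norm_num))
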